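/- Let $(X,\omega)$ be a compact Kähler manifold of dimension $n$, with volume $V=\int_X \omega^n/n!$, and let $E\to X$ be a holomorphic vector bundle of rank $r$ which is globally generated (for instance, very ample). Let $N=\dim H^0(X,E)$, let $K$ be the space of smooth Hermitian metrics on $E$, and let $M$ be the space of Hermitian inner products on $H^0(X,E)$. Define: * $\mathrm{Hilb}:K\to M$ by $\langle s,t\rangle_{\mathrm{Hilb}(h)}=\frac{N}{Vr}\int_X\langle s(x),t(x)\rangle_h\,\frac{\omega^n}{n!}$; * $FS:M\to K$, where $FS(H)$ is the unique metric on $E$ with $\sum_{i} s_i\otimes s_i^{*_{FS(H)}}=I$ for $H$-orthonormal bases $s_1,\dots,s_N$ of $H^0(X,E)$ (here $s\otimes s^{*_h}$ is the endomorphism $v\mapsto h(v,s)\,s$); * $T=\mathrm{Hilb}\circ FS:M\to M$; * $\log\det:M\to\mathbb R$, $\log\det H=\log\det[H(\theta_i,\theta_j)]$, where $\theta_1,\dots,\theta_N$ is a fixed basis of $H^0(X,E)$; * $I:K\to\mathbb R$, $I(h)=\int_X\log\det(h_0^{-1}h)\,\frac{\omega^n}{n!}$, where $h_0\in K$ is a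 fixed background metric; thus $I(e^{\varphi}h_0)=\int_X \mathrm{tr}(\varphi)\,\frac{\omega^n}{n!}$, and $\frac{d}{dt}I(e^{\varphi_t}h_0)=\int_X\mathrm{tr}(\dot\varphi_t)\,\frac{\omega^n}{n!}$; * $Z=-I\circ FS:M\to\mathbb R$ and $\widetilde Z=Z+\frac{rV}{N}\log\det:M\to\mathbb R$. Then for every $H\in M$: $$Z(H)\ge Z(T(H)),\qquad \log\det H\ge\log\det T(H),\qquad \widetilde Z(H)\ge\widetilde Z(T(H)).$$ -/

import Mathlib

open scoped Manifold ContDiff Bundle Topology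
open MeasureTheory Bundle

namespace BalancedMetrics

noncomputable section

section Kahler

open scoped ComplexOrder

/-- The derivative at `z` of the inverse of the preferred chart at `x₀`. -/
def chartSymmDeriv {n : ℕ} {X : Type*} [TopologicalSpace X] [ChartedSpace (Fin n → ℂ) X]
    (x₀ : X) (z : Fin n → ℂ) :
    (Fin n → ℂ) →L[ℂ] TangentSpace 𝓘(ℂ, Fin n → ℂ) ((chartAt (Fin n → ℂ) x₀).symm z) :=
  mfderiv 𝓘(ℂ, Fin n → ℂ) 𝓘(ℂ, Fin n → ℂ) (chartAt (Fin n → ℂ) x₀).symm z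

/-- The coordinate expression, in the preferred chart at `x₀`, of a field `α` of alternating real
`2`-forms on a complex manifold: the pull-back of `α` under the inverse of the chart. -/
def inChart {n : ℕ} {X : Type*} [TopologicalSpace X] [ChartedSpace (Fin n → ℂ) X]
    (α : ∀ x : X, (TangentSpace 𝓘(ℂ, Fin n → ℂ) x) [⋀^Fin 2]→L[ℝ] ℝ) (x₀ : X)
    (z : Fin n → ℂ) : (Fin n → ℂ) [⋀^Fin 2]→L[ℝ] ℝ :=
  (α ((chartAt (Fin n → ℂ) x₀).symm z)).compContinuousLinearMap
    ((chartSymmDeriv x₀ z).restrictScalars ℝ)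

/-- A Kähler form on the complex manifold `X` of dimension `n`: a smooth closed real `2`-form of
type `(1, 1)` which is positive. -/
structure KahlerForm (n : ℕ) (X : Type*) [TopologicalSpace X] [ChartedSpace (Fin n → ℂ) X] where
  form : ∀ x : X, (TangentSpace 𝓘(ℂ, Fin n → ℂ) x) [⋀^Fin 2]→L[ℝ] ℝ
  map_I_smul : ∀ x v w, form x ![Complex.I • v, Complex.I • w] = form x ![v, w]
  pos : ∀ x v, v ≠ 0 → 0 < form x ![v, Complex.I • v]
  smooth : ∀ x₀ : X, ContDiffOn ℝ ∞ (inChart form x₀) (chartAt (Fin n → ℂ) x₀).target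
  closed : ∀ x₀ : X, ∀ z ∈ (chartAt (Fin n → ℂ) x₀).target, extDeriv (inChart form x₀) z = 0

variable {n : ℕ} {X : Type*} [TopologicalSpace X] [ChartedSpace (Fin n → ℂ) X]

/-- The Hermitian matrix `(g_{jk})` of a Kähler form in the chart at `x₀`, i.e.
`κ = (i/2) ∑ g_{jk} dz_j ∧ dz̄_k`. In terms of the coordinate vectors `∂_j`,
`g_{jk} = κ(∂_j, i ∂_k) - i κ(∂_j, ∂_k)`. -/
def KahlerForm.matrix (κ : KahlerForm n X) (x₀ : X) (z : Fin n → ℂ) :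
    Matrix (Fin n) (Fin n) ℂ :=
  Matrix.of fun j k =>
    (inChart κ.form x₀ z ![Pi.single j 1, Complex.I • Pi.single k 1] : ℂ) -
      Complex.I * (inChart κ.form x₀ z ![Pi.single j 1, Pi.single k 1] : ℂ)

/-- The density of the volume form `κ ^ n / n!` with respect to Lebesgue measure in the chart at
`x₀`: if `κ = (i/2) ∑ g_{jk} dz_j ∧ dz̄_k`, then `κ ^ n / n! = det (g_{jk}) dLebesgue`. -/
def KahlerForm.density (κ : KahlerForm n X) (x₀ : X) (z : Fin n → ℂ) : ℝ :=
  (κ.matrix x₀ z).det.re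

theorem inChart_apply (κ : KahlerForm n X) (x₀ : X) (z v w : Fin n → ℂ) :
    inChart κ.form x₀ z ![v, w] =
      κ.form ((chartAt (Fin n → ℂ) x₀).symm z) ![chartSymmDeriv x₀ z v, chartSymmDeriv x₀ z w] := by
  unfold inChart
  rw [ContinuousAlternatingMap.compContinuousLinearMap_apply]
  congr 1
  ext i
  fin_cases i <;> rfl

theorem inChart_pos [IsManifold 𝓘(ℂ, Fin n → ℂ) ω X] (κ : KahlerForm n X) (x₀ : X)
    {z : Fin n → ℂ} (hz : z ∈ (chartAt (Fin n → ℂ) x₀).target) {v : Fin n → ℂ} (hv : v ≠ 0) :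
    0 < inChart κ.form x₀ z ![v, Complex.I • v] := by
  have h1 : IsManifold 𝓘(ℂ, Fin n → ℂ) 1 X := IsManifold.of_le (n := ω) le_top
  have hinv := isInvertible_mfderivWithin_extChartAt_symm (I := 𝓘(ℂ, Fin n → ℂ)) (x := x₀) (y := z)
    (by simpa using hz)
  have hinj : Function.Injective (chartSymmDeriv x₀ z) := by
    have h2 := hinv.injective
    rw [modelWithCornersSelf_coe, Set.range_id, mfderivWithin_univ] at h2
    have e : ((extChartAt 𝓘(ℂ, Fin n → ℂ) x₀).symm : (Fin n → ℂ) → X) =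
      (chartAt (Fin n → ℂ) x₀).symm := by simp [extChartAt, mfld_simps]
    rw [e] at h2
    exact h2
  have h3 : chartSymmDeriv x₀ z v ≠ 0 := fun h => hv (hinj (by rw [h, map_zero]))
  have h4 := κ.pos _ _ h3
  rw [inChart_apply, map_smul]
  exact h4

theorem inChart_I_smul (κ : KahlerForm n X) (x₀ : X) (z v w : Fin n → ℂ) :
    inChart κ.form x₀ z ![Complex.I • v, Complex.I • w] = inChart κ.form x₀ z ![v, w] := by
  rw [inChart_apply, inChart_apply, map_smul, map_smul, κ.map_I_smul]

theorem continuousOn_density (κ : KahlerForm n X) (x₀ : X) :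
    ContinuousOn (κ.density x₀) (chartAt (Fin n → ℂ) x₀).target := by
  have h := (κ.smooth x₀).continuousOn
  have h2 : ∀ m : Fin 2 → Fin n → ℂ, ContinuousOn (fun z => inChart κ.form x₀ z m)
      (chartAt (Fin n → ℂ) x₀).target := fun m =>
    ((ContinuousAlternatingMap.apply ℝ (Fin n → ℂ) ℝ m).continuous.comp_continuousOn h)
  have h3 : ContinuousOn (κ.matrix x₀) (chartAt (Fin n → ℂ) x₀).target := by
    unfold KahlerForm.matrix
    refine continuousOn_pi.2 fun j => continuousOn_pi.2 fun k => ?_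
    exact (Complex.continuous_ofReal.comp_continuousOn (h2 _)).sub
      (continuousOn_const.mul (Complex.continuous_ofReal.comp_continuousOn (h2 _)))
  unfold KahlerForm.density
  exact Complex.continuous_re.comp_continuousOn
    ((Continuous.matrix_det continuous_id).comp_continuousOn h3)

theorem density_pos [IsManifold 𝓘(ℂ, Fin n → ℂ) ω X] (κ : KahlerForm n X) (x₀ : X)
    {z : Fin n → ℂ} (hz : z ∈ (chartAt (Fin n → ℂ) x₀).target) : 0 < κ.density x₀ z := by
  set α := inChart κ.form x₀ z with hα
  -- the real bilinear form underlying `α`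
  set B : (Fin n → ℂ) → (Fin n → ℂ) → ℝ := fun v w => α ![v, w] with hB
  have add_l : ∀ u v w, B (u + v) w = B u w + B v w := fun u v w => by
    simpa [hB] using α.toAlternatingMap.map_vecCons_add (m := ![w]) u v
  have smul_l : ∀ (c : ℝ) v w, B (c • v) w = c * B v w := fun c v w => by
    simpa [hB] using α.toAlternatingMap.map_vecCons_smul (m := ![w]) c v
  have swap : ∀ v w, B v w = - B w v := fun v w => by
    have := α.toAlternatingMap.map_swap ![w, v] (i := 0) (j := 1) (by simp)
    simp only [hB]
    rw [← ContinuousAlternatingMap.coe_toAlternatingMap]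
    rw [← this]
    congr 1
    ext i
    fin_cases i <;> simp
  have hI : ∀ v w, B (Complex.I • v) (Complex.I • w) = B v w := inChart_I_smul κ x₀ z
  have add_r : ∀ u v w, B u (v + w) = B u v + B u w := fun u v w => by
    rw [swap, add_l, swap v, swap w]; ring
  have smul_r : ∀ (c : ℝ) v w, B v (c • w) = c * B v w := fun c v w => by
    rw [swap, smul_l, swap w]; ring
  -- the Hermitian form
  set h : (Fin n → ℂ) → (Fin n → ℂ) → ℂ := fun v w =>
    (B v (Complex.I • w) : ℂ) - Complex.I * (B v w : ℂ) with hh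
  have II : ∀ v : Fin n → ℂ, Complex.I • (Complex.I • v) = (-1 : ℝ) • v := fun v => by
    rw [smul_smul, Complex.I_mul_I]; simp
  have hadd : ∀ u v w, h (u + v) w = h u w + h v w := fun u v w => by
    simp only [hh, add_l]; push_cast; ring
  have BI : ∀ v w, B (Complex.I • v) w = - B v (Complex.I • w) := fun v w => by
    have := hI (Complex.I • v) w
    rw [II, smul_l] at this
    have h5 := hI v (Complex.I • w)
    rw [II, smul_r] at h5
    linarith
  have hsmul : ∀ (c : ℂ) v w, h (c • v) w = c * h v w := fun c v w => by
    have e : c • v = c.re • v + c.im • (Complex.I • v) := by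
      ext i
      simp only [Pi.smul_apply, Pi.add_apply, smul_eq_mul, Complex.real_smul]
      conv_lhs => rw [← Complex.re_add_im c]
      ring
    have hIv : h (Complex.I • v) w = Complex.I * h v w := by
      simp only [hh, hI, BI]
      push_cast
      linear_combination (B v w : ℂ) * Complex.I_mul_I
    have hr : ∀ (a : ℝ) u, h (a • u) w = a * h u w := fun a u => by
      simp only [hh, smul_l]; push_cast; ring
    rw [e, hadd, hr, hr, hIv]
    conv_rhs => rw [← Complex.re_add_im c]
    ring
  have hconj : ∀ v w, (starRingEnd ℂ) (h w v) = h v w := fun v w => by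
    simp only [hh, map_sub, map_mul, Complex.conj_ofReal, Complex.conj_I]
    rw [swap w v, swap w (Complex.I • v), BI]
    push_cast; ring
  have hsum : ∀ {ι : Type} (s : Finset ι) (c : ι → ℂ) (f : ι → Fin n → ℂ) w,
      h (∑ i ∈ s, c i • f i) w = ∑ i ∈ s, c i * h (f i) w := by
    intro ι s c f w
    classical
    induction s using Finset.induction_on with
    | empty => simpa using hsmul 0 0 w
    | insert a s ha ih => rw [Finset.sum_insert ha, Finset.sum_insert ha, hadd, hsmul, ih]
  have hM : ∀ j k, κ.matrix x₀ z j k = h (Pi.single j 1) (Pi.single k 1) := fun j k => rfl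
  have hherm : (κ.matrix x₀ z).IsHermitian := by
    ext j k
    rw [Matrix.conjTranspose_apply, hM, hM]
    exact hconj _ _
  have hexp : ∀ u : Fin n → ℂ, ∑ j, u j • (Pi.single j 1 : Fin n → ℂ) = u := fun u => by
    ext i
    simp [Finset.sum_apply, Pi.single_apply]
  have hpos : (κ.matrix x₀ z).PosDef := by
    refine Matrix.PosDef.of_dotProduct_mulVec_pos hherm fun x hx => ?_
    have hu : star x ≠ 0 := by simpa using hx
    have key : star x ⬝ᵥ (κ.matrix x₀ z).mulVec x = h (star x) (star x) := by
      conv_rhs => rw [← hexp (star x)]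
      rw [hsum]
      simp only [dotProduct, Matrix.mulVec]
      refine Finset.sum_congr rfl fun j _ => ?_
      congr 1
      rw [hexp, ← hconj, ← hexp (star x), hsum, map_sum]
      refine Finset.sum_congr rfl fun k _ => ?_
      rw [map_mul, hconj, hM, mul_comm]
      congr 1
      simp
    rw [key]
    have h0 : B (star x) (star x) = 0 := by have := swap (star x) (star x); linarith
    simp only [hh, h0]
    have := inChart_pos κ x₀ hz hu
    simpa [hB] using this
  have := hpos.det_pos
  exact (Complex.lt_def.1 this).1

theorem aemeasurable_chart_symm [MeasurableSpace X] [BorelSpace X] (x₀ : X) (f : (Fin n → ℂ) → ENNReal) :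
    AEMeasurable (chartAt (Fin n → ℂ) x₀).symm
      ((volume.restrict (chartAt (Fin n → ℂ) x₀).target).withDensity f) :=
  ((chartAt (Fin n → ℂ) x₀).continuousOn_symm.aemeasurable
    (chartAt (Fin n → ℂ) x₀).open_target.measurableSet).mono_ac 
      (withDensity_absolutelyContinuous _ _)

variable (n X) in
theorem exists_chartPartition [T2Space X] [CompactSpace X] :
    ∃ ρ : PartitionOfUnity X X, ρ.IsSubordinate fun x => (chartAt (Fin n → ℂ) x).source :=
  PartitionOfUnity.exists_isSubordinate isClosed_univ _
    (fun x => (chartAt (Fin n → ℂ) x).open_source)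
    (fun x _ => Set.mem_iUnion.2 ⟨x, mem_chart_source _ x⟩)

variable (n X) in
/-- A partition of unity subordinate to the cover of `X` by the domains of the charts. -/
def chartPartition [T2Space X] [CompactSpace X] : PartitionOfUnity X X :=
  (exists_chartPartition n X).choose

theorem chartPartition_isSubordinate [T2Space X] [CompactSpace X] :
    (chartPartition n X).IsSubordinate fun x => (chartAt (Fin n → ℂ) x).source :=
  (exists_chartPartition n X).choose_spec

variable [T2Space X] [CompactSpace X] [MeasurableSpace X]

/-- The measure on `X` given by the part of the volume form `κ ^ n / n!` cut out by the member `x₀`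
of the partition of unity. -/
def KahlerForm.localVolume (κ : KahlerForm n X) (x₀ : X) : Measure X :=
  Measure.map (chartAt (Fin n → ℂ) x₀).symm
    ((volume.restrict (chartAt (Fin n → ℂ) x₀).target).withDensity fun z =>
      ENNReal.ofReal (chartPartition n X x₀ ((chartAt (Fin n → ℂ) x₀).symm z) * κ.density x₀ z))

/-- The measure on `X` defined by the volume form `κ ^ n / n!`, with integrals computed in charts
by means of a partition of unity. -/
def KahlerForm.volume (κ : KahlerForm n X) : Measure X :=
  Measure.sum κ.localVolume

/-- `V = Vol(X, κ)`. -/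
def KahlerForm.totalVolume (κ : KahlerForm n X) : ℝ :=
  κ.volume.real Set.univ


theorem localVolume_apply [BorelSpace X] (κ : KahlerForm n X) (x₀ : X) {s : Set X}
    (hs : MeasurableSet s) : κ.localVolume x₀ s =
      ∫⁻ z in (chartAt (Fin n → ℂ) x₀).target ∩ (chartAt (Fin n → ℂ) x₀).symm ⁻¹' s,
        ENNReal.ofReal (chartPartition n X x₀ ((chartAt (Fin n → ℂ) x₀).symm z) *
          κ.density x₀ z) := by
  have hpre : NullMeasurableSet ((chartAt (Fin n → ℂ) x₀).symm ⁻¹' s)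
      (volume.restrict (chartAt (Fin n → ℂ) x₀).target) :=
    ((chartAt (Fin n → ℂ) x₀).continuousOn_symm.aemeasurable
      (chartAt (Fin n → ℂ) x₀).open_target.measurableSet).nullMeasurable hs
  rw [KahlerForm.localVolume, Measure.map_apply_of_aemeasurable (aemeasurable_chart_symm x₀ _) hs,
    withDensity_apply₀ _ hpre, Measure.restrict_restrict₀ hpre, Set.inter_comm]

theorem isFiniteMeasure_localVolume [BorelSpace X] (κ : KahlerForm n X) (x₀ : X) :
    κ.localVolume x₀ Set.univ < ⊤ := by
  set φ := chartAt (Fin n → ℂ) x₀ with hφ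
  set ρ := chartPartition n X x₀ with hρ
  have hK : IsCompact (tsupport ρ) := (isClosed_tsupport _).isCompact
  have hsub : tsupport ρ ⊆ φ.source := chartPartition_isSubordinate x₀
  have hK' : IsCompact (φ '' tsupport ρ) := hK.image_of_continuousOn (φ.continuousOn.mono hsub)
  have hK't : φ '' tsupport ρ ⊆ φ.target := by
    rintro _ ⟨x, hx, rfl⟩
    exact φ.map_source (hsub hx)
  obtain ⟨C, hC⟩ := hK'.exists_bound_of_continuousOn ((continuousOn_density κ x₀).mono hK't)
  rw [localVolume_apply κ x₀ MeasurableSet.univ, Set.preimage_univ, Set.inter_univ]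
  calc _ ≤ ∫⁻ z in φ.target, (φ '' tsupport ρ).indicator (fun _ => ENNReal.ofReal C) z := by
        refine setLIntegral_mono' φ.open_target.measurableSet fun z hz => ?_
        by_cases hzK : z ∈ φ '' tsupport ρ
        · rw [Set.indicator_of_mem hzK]
          refine ENNReal.ofReal_le_ofReal ?_
          have h1 := (chartPartition n X).nonneg x₀ (φ.symm z)
          have h2 := (chartPartition n X).le_one x₀ (φ.symm z)
          have h3 := hC z hzK
          rw [Real.norm_eq_abs] at h3
          have h4 := abs_nonneg (κ.density x₀ z)
          calc _ ≤ (chartPartition n X x₀ (φ.symm z)) * |κ.density x₀ z| :=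
                mul_le_mul_of_nonneg_left (le_abs_self _) h1
            _ ≤ 1 * |κ.density x₀ z| := mul_le_mul_of_nonneg_right h2 h4
            _ ≤ C := by rwa [one_mul]
        · have : ρ (φ.symm z) = 0 := by
            refine image_eq_zero_of_notMem_tsupport fun h => hzK ⟨_, h, φ.right_inv hz⟩
          rw [this]
          simp
    _ ≤ ∫⁻ z, (φ '' tsupport ρ).indicator (fun _ => ENNReal.ofReal C) z :=
        setLIntegral_le_lintegral _ _
    _ = ENNReal.ofReal C * volume (φ '' tsupport ρ) :=
        lintegral_indicator_const hK'.measurableSet _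
    _ < ⊤ := ENNReal.mul_lt_top ENNReal.ofReal_lt_top hK'.measure_lt_top

instance isFiniteMeasure_volume [BorelSpace X] (κ : KahlerForm n X) :
    IsFiniteMeasure κ.volume := by
  refine ⟨?_⟩
  have hfin : {i : X | (Function.support (chartPartition n X i)).Nonempty}.Finite :=
    (chartPartition n X).locallyFinite.finite_nonempty_of_compact
  have hzero : ∀ i ∉ hfin.toFinset, κ.localVolume i Set.univ = 0 := by
    intro i hi
    rw [Set.Finite.mem_toFinset, Set.mem_ofPred_eq, Set.not_nonempty_iff_eq_empty,
      Function.support_eq_empty_iff] at hi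
    rw [localVolume_apply κ i MeasurableSet.univ]
    simp [hi]
  rw [KahlerForm.volume, Measure.sum_apply _ MeasurableSet.univ, tsum_eq_sum hzero]
  exact ENNReal.sum_lt_top.2 fun i _ => isFiniteMeasure_localVolume κ i

instance isOpenPosMeasure_volume [BorelSpace X] [IsManifold 𝓘(ℂ, Fin n → ℂ) ω X]
    (κ : KahlerForm n X) : κ.volume.IsOpenPosMeasure := by
  refine ⟨fun U hU ⟨x, hx⟩ h0 => ?_⟩
  obtain ⟨i, hi⟩ := (chartPartition n X).exists_pos (Set.mem_univ x)
  set φ := chartAt (Fin n → ℂ) i with hφ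
  set ρ := chartPartition n X i with hρ
  rw [KahlerForm.volume, Measure.sum_apply _ hU.measurableSet, ENNReal.tsum_eq_zero] at h0
  have h1 := h0 i
  have hxs : x ∈ φ.source := chartPartition_isSubordinate i
    (subset_tsupport _ (Function.mem_support.2 hi.ne'))
  set W := φ.target ∩ φ.symm ⁻¹' (U ∩ {y | 0 < ρ y}) with hW
  have hWo : IsOpen W := φ.isOpen_inter_preimage_symm
    (hU.inter (isOpen_lt continuous_const ρ.continuous))
  have hWn : W.Nonempty := ⟨φ x, φ.map_source hxs, by
    simp only [Set.mem_preimage, φ.left_inv hxs]; exact ⟨hx, hi⟩⟩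
  rw [localVolume_apply κ i hU.measurableSet] at h1
  have h2 : ∫⁻ z in W, ENNReal.ofReal (ρ (φ.symm z) * κ.density i z) = 0 := by
    refine le_antisymm (le_trans (lintegral_mono_set ?_) h1.le) bot_le
    exact fun z hz => ⟨hz.1, hz.2.1⟩
  have h3 : ∀ z ∈ W, 0 < ENNReal.ofReal (ρ (φ.symm z) * κ.density i z) := fun z hz =>
    ENNReal.ofReal_pos.2 (mul_pos hz.2.2 (density_pos κ i hz.1))
  have hcont : ContinuousOn (fun z => ρ (φ.symm z) * κ.density i z) W :=
    ((ρ.continuous.comp_continuousOn φ.continuousOn_symm).mul (continuousOn_density κ i)).mono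
      fun z hz => hz.1
  have hmeas : AEMeasurable (fun z => ENNReal.ofReal (ρ (φ.symm z) * κ.density i z))
      (volume.restrict W) :=
    (ENNReal.continuous_ofReal.comp_continuousOn hcont).aemeasurable hWo.measurableSet
  rw [lintegral_eq_zero_iff' hmeas, Filter.EventuallyEq,
    ae_restrict_iff' hWo.measurableSet] at h2
  have h4 : volume W = 0 := by
    refine measure_mono_null (fun z hz => ?_) h2
    exact fun h => (h3 z hz).ne' (h hz)
  exact (hWo.measure_pos volume hWn).ne' h4

end Kahler

section Sections

variable (n r : ℕ) {X : Type*} [TopologicalSpace X] [ChartedSpace (Fin n → ℂ) X]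
  (E : X → Type*) [∀ x, AddCommGroup (E x)] [∀ x, Module ℂ (E x)] [∀ x, TopologicalSpace (E x)]
  [TopologicalSpace (TotalSpace (Fin r → ℂ) E)] [FiberBundle (Fin r → ℂ) E]

/-- `H⁰(X, E)`, the space of holomorphic sections of `E`. -/
abbrev HolSection : Type _ :=
  ContMDiffSection 𝓘(ℂ, Fin n → ℂ) (Fin r → ℂ) ω E

variable {n r E}

/-- The coordinates of a section in the preferred trivialization at `x₀`. -/
def localRep (x₀ : X) (s : HolSection n r E) (x : X) : Fin r → ℂ :=
  (trivializationAt (Fin r → ℂ) E x₀ ⟨x, s x⟩).2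

variable [VectorBundle ℂ (Fin r → ℂ) E]

theorem localRep_add (x₀ : X) (s t : HolSection n r E) {x : X}
    (hx : x ∈ (trivializationAt (Fin r → ℂ) E x₀).baseSet) :
    localRep x₀ (s + t) x = localRep x₀ s x + localRep x₀ t x :=
  ((trivializationAt (Fin r → ℂ) E x₀).linear ℂ hx).map_add _ _

theorem localRep_smul (x₀ : X) (c : ℂ) (s : HolSection n r E) {x : X}
    (hx : x ∈ (trivializationAt (Fin r → ℂ) E x₀).baseSet) :
    localRep x₀ (c • s) x = c • localRep x₀ s x :=
  ((trivializationAt (Fin r → ℂ) E x₀).linear ℂ hx).map_smul _ _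

theorem eq_zero_of_localRep (x₀ : X) (s : HolSection n r E) {x : X}
    (hx : x ∈ (trivializationAt (Fin r → ℂ) E x₀).baseSet) (h : localRep x₀ s x = 0) : s x = 0 := by
  have := ((trivializationAt (Fin r → ℂ) E x₀).linearEquivAt ℂ x hx).map_eq_zero_iff (x := s x)
  exact this.1 h

theorem localRep_coordChange (x₀ x₁ : X) (s : HolSection n r E) {x : X}
    (hx : x ∈ (trivializationAt (Fin r → ℂ) E x₀).baseSet)
    (hx' : x ∈ (trivializationAt (Fin r → ℂ) E x₁).baseSet) :
    localRep x₁ s x = (((trivializationAt (Fin r → ℂ) E x₀).coordChangeL ℂ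
      (trivializationAt (Fin r → ℂ) E x₁) x : (Fin r → ℂ) ≃L[ℂ] (Fin r → ℂ)) :
        (Fin r → ℂ) →L[ℂ] (Fin r → ℂ)) (localRep x₀ s x) := by
  rw [ContinuousLinearEquiv.coe_coe, Trivialization.coordChangeL_apply _ _ ⟨hx, hx'⟩]
  unfold localRep
  rw [← Trivialization.linearEquivAt_symm_apply (R := ℂ) _ _ hx]
  congr 3
  exact (((trivializationAt (Fin r → ℂ) E x₀).linearEquivAt ℂ x hx).symm_apply_apply (s x)).symm

variable [ContMDiffVectorBundle ω (Fin r → ℂ) E 𝓘(ℂ, Fin n → ℂ)]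

theorem contMDiffOn_localRep (x₀ : X) (s : HolSection n r E) :
    ContMDiffOn 𝓘(ℂ, Fin n → ℂ) 𝓘(ℂ, Fin r → ℂ) ω (localRep x₀ s)
      (trivializationAt (Fin r → ℂ) E x₀).baseSet :=
  ((trivializationAt (Fin r → ℂ) E x₀).contMDiffOn_section_iff
    (trivializationAt (Fin r → ℂ) E x₀).open_baseSet subset_rfl).1 s.contMDiff.contMDiffOn

variable [IsManifold 𝓘(ℂ, Fin n → ℂ) ω X]

theorem contDiffOn_localRep (x₀ x₁ : X) (s : HolSection n r E) :
    ContDiffOn ℂ ω (localRep x₀ s ∘ (chartAt (Fin n → ℂ) x₁).symm)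
      ((chartAt (Fin n → ℂ) x₁).target ∩ (chartAt (Fin n → ℂ) x₁).symm ⁻¹'
        (trivializationAt (Fin r → ℂ) E x₀).baseSet) :=
  contMDiffOn_iff_contDiffOn.1 ((contMDiffOn_localRep x₀ s).comp
    (contMDiffOn_chart_symm.mono Set.inter_subset_left) fun _ hz => hz.2)

/-- The space of holomorphic sections over a compact manifold is finite-dimensional: by the Schwarz
lemma, a section vanishing at the points of a sufficiently fine finite net is zero. -/
instance finiteDimensional_holSection [CompactSpace X] [T2Space X] :
    FiniteDimensional ℂ (HolSection n r E) := by
  classical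
  set φ : X → OpenPartialHomeomorph X (Fin n → ℂ) := fun x => chartAt (Fin n → ℂ) x with hφ
  set e := fun x : X => trivializationAt (Fin r → ℂ) E x with he
  have hW : ∀ x, IsOpen ((φ x).target ∩ (φ x).symm ⁻¹' (e x).baseSet) := fun x =>
    (φ x).isOpen_inter_preimage_symm (e x).open_baseSet
  have hR : ∀ x, ∃ R > 0, Metric.closedBall (φ x x) R ⊆
      (φ x).target ∩ (φ x).symm ⁻¹' (e x).baseSet := fun x =>
    Metric.nhds_basis_closedBall.mem_iff.1 ((hW x).mem_nhds ⟨mem_chart_target _ x, by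
      simp only [Set.mem_preimage, hφ, he]
      rw [(chartAt (Fin n → ℂ) x).left_inv (mem_chart_source _ x)]
      exact FiberBundle.mem_baseSet_trivializationAt' x⟩)
  choose R hR0 hRs using hR
  set H : X → Set X := fun x => (φ x).source ∩ φ x ⁻¹' Metric.ball (φ x x) (R x / 2) with hH
  have hHo : ∀ x, IsOpen (H x) := fun x => (φ x).isOpen_inter_preimage Metric.isOpen_ball
  have hHx : ∀ x, x ∈ H x := fun x => ⟨mem_chart_source _ x,
    Metric.mem_ball_self (x := φ x x) (half_pos (hR0 x))⟩
  obtain ⟨t, ht⟩ := isCompact_univ.elim_finite_subcover H hHo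
    (fun x _ => Set.mem_iUnion.2 ⟨x, hHx x⟩)
  have ht' : ∀ y, ∃ i ∈ t, y ∈ H i := fun y => by simpa using ht (Set.mem_univ y)
  set K : X → Set X := fun x => (φ x).symm '' Metric.closedBall (φ x x) (R x) with hK
  have hKc : ∀ x, IsCompact (K x) := fun x =>
    (isCompact_closedBall _ _).image_of_continuousOn
      ((φ x).continuousOn_symm.mono fun z hz => (hRs x hz).1)
  have hKb : ∀ x, K x ⊆ (e x).baseSet := by
    rintro x _ ⟨z, hz, rfl⟩
    exact (hRs x hz).2
  have hHK : ∀ x, H x ⊆ K x := fun x y hy =>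
    ⟨φ x y, Metric.ball_subset_closedBall (Metric.ball_subset_ball (by linarith [hR0 x]) hy.2),
      (φ x).left_inv hy.1⟩
  -- bounds for the transition functions
  have hC : ∀ i j, ∃ C, ∀ y ∈ K i ∩ K j, ∀ s : HolSection n r E,
      ‖localRep j s y‖ ≤ C * ‖localRep i s y‖ := by
    intro i j
    obtain ⟨C, hC⟩ := ((hKc i).inter (hKc j)).exists_bound_of_continuousOn
      ((continuousOn_coordChange ℂ (e i) (e j)).mono
        (Set.inter_subset_inter (hKb i) (hKb j)))
    refine ⟨C, fun y hy s => ?_⟩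
    rw [localRep_coordChange i j s (hKb i hy.1) (hKb j hy.2)]
    exact (ContinuousLinearMap.le_opNorm _ _).trans
      (mul_le_mul_of_nonneg_right (hC y hy) (norm_nonneg _))
  choose C' hC' using hC
  set C : ℝ := ∑ i ∈ t, ∑ j ∈ t, |C' i j| with hCdef
  have hC0 : 0 ≤ C := Finset.sum_nonneg fun i _ => Finset.sum_nonneg fun j _ => abs_nonneg _
  have hC : ∀ i ∈ t, ∀ j ∈ t, ∀ y ∈ K i ∩ K j, ∀ s : HolSection n r E,
      ‖localRep j s y‖ ≤ C * ‖localRep i s y‖ := by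
    intro i hi j hj y hy s
    refine (hC' i j y hy s).trans (mul_le_mul_of_nonneg_right ?_ (norm_nonneg _))
    calc C' i j ≤ |C' i j| := le_abs_self _
      _ ≤ ∑ j ∈ t, |C' i j| := Finset.single_le_sum (f := fun j => |C' i j|)
          (fun j _ => abs_nonneg _) hj
      _ ≤ C := Finset.single_le_sum (f := fun i => ∑ j ∈ t, |C' i j|)
          (fun i _ => Finset.sum_nonneg fun j _ => abs_nonneg _) hi
  -- nets
  have hP : ∀ i, ∃ P ⊆ Metric.closedBall (φ i i) (R i / 2), P.Finite ∧
      Metric.closedBall (φ i i) (R i / 2) ⊆ ⋃ p ∈ P, Metric.ball p (R i / (4 * (C + 1))) := fun i =>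
    (isCompact_closedBall _ _).finite_cover_balls (div_pos (hR0 i) (by linarith))
  choose P hPs hPf hPc using hP
  have hPb : ∀ i, ∀ p ∈ P i, (φ i).symm p ∈ (e i).baseSet := fun i p hp =>
    (hRs i (Metric.closedBall_subset_closedBall (by linarith [hR0 i]) (hPs i hp))).2
  have : ∀ i, Finite (P i) := fun i => (hPf i).to_subtype
  let L : HolSection n r E →ₗ[ℂ] (∀ i : t, P i → Fin r → ℂ) :=
    { toFun := fun s i p => localRep (i : X) s ((φ i).symm p)
      map_add' := fun s s' => by
        funext i p
        exact localRep_add _ _ _ (hPb i p p.2)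
      map_smul' := fun c s => by
        funext i p
        exact localRep_smul _ _ _ (hPb i p p.2) }
  refine Module.Finite.of_injective L ?_
  rw [← LinearMap.ker_eq_bot, LinearMap.ker_eq_bot']
  intro s hs
  have hs' : ∀ i ∈ t, ∀ p ∈ P i, localRep i s ((φ i).symm p) = 0 := fun i hi p hp =>
    congrFun (congrFun hs ⟨i, hi⟩) ⟨p, hp⟩
  rcases t.eq_empty_or_nonempty with rfl | hne
  · ext x
    obtain ⟨i, hi, -⟩ := ht' x
    simp at hi
  have hcont : ∀ i, ContinuousOn (localRep i s) (K i) := fun i =>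
    (contMDiffOn_localRep i s).continuousOn.mono (hKb i)
  have hmax : ∀ i, ∃ y ∈ K i, ∀ y' ∈ K i, ‖localRep i s y'‖ ≤ ‖localRep i s y‖ := fun i =>
    (hKc i).exists_isMaxOn ⟨i, hHK i (hHx i)⟩ (hcont i).norm
  choose y hyK hy using hmax
  obtain ⟨j, hj, hjmax⟩ := t.exists_max_image (fun i => ‖localRep i s (y i)‖) hne
  set M := ‖localRep j s (y j)‖ with hM
  have hbound : ∀ i ∈ t, ∀ y' ∈ K i, ‖localRep i s y'‖ ≤ M := fun i hi y' hy' =>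
    (hy i y' hy').trans (hjmax i hi)
  have hM0 : M ≤ 0 := by
    obtain ⟨i, hi, hji⟩ := ht' (y j)
    have hz : φ i (y j) ∈ Metric.closedBall (φ i i) (R i / 2) := Metric.ball_subset_closedBall hji.2
    obtain ⟨p, hp, hzp⟩ := Set.mem_iUnion₂.1 (hPc i hz)
    have hsub : Metric.ball p (R i / 2) ⊆ Metric.closedBall (φ i i) (R i) := by
      intro w hw
      have h1 := hPs i hp
      rw [Metric.mem_closedBall] at h1 ⊢
      rw [Metric.mem_ball] at hw
      linarith [dist_triangle w p (φ i i)]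
    have hC1 : 1 ≤ C + 1 := by linarith
    have hzball : φ i (y j) ∈ Metric.ball p (R i / 2) := by
      refine Metric.ball_subset_ball ?_ hzp
      rw [div_le_div_iff₀ (by linarith) (by norm_num)]
      nlinarith [hR0 i]
    have hS := Complex.dist_le_div_mul_dist_of_mapsTo_ball
      (f := localRep i s ∘ (φ i).symm) (c := p) (R₁ := R i / 2) (R₂ := M)
      (((contDiffOn_localRep i i s).differentiableOn (by simp)).mono (hsub.trans (hRs i)))
      (by
        intro w hw
        rw [Metric.mem_closedBall, Function.comp_apply, Function.comp_apply, hs' i hi p hp,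
          dist_zero_right]
        exact hbound i hi _ ⟨w, hsub hw, rfl⟩) hzball
    rw [Function.comp_apply, Function.comp_apply, hs' i hi p hp, dist_zero_right,
      (φ i).left_inv hji.1] at hS
    have h2 := hC i hi j hj (y j) ⟨hHK i hji, hyK j⟩ s
    rw [Metric.mem_ball] at hzp
    have hMn : 0 ≤ M := norm_nonneg _
    have hRi := hR0 i
    have h3 : M / (R i / 2) * dist (φ i (y j)) p ≤ M / (R i / 2) * (R i / (4 * (C + 1))) :=
      mul_le_mul_of_nonneg_left hzp.le (by positivity)
    have h4 : M / (R i / 2) * (R i / (4 * (C + 1))) = M / (2 * (C + 1)) := by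
      field_simp; ring
    have h5 : M ≤ C * (M / (2 * (C + 1))) := by
      refine h2.trans (mul_le_mul_of_nonneg_left ?_ hC0)
      linarith
    have h6 : C * (M / (2 * (C + 1))) ≤ M / 2 := by
      rw [← mul_div_assoc, div_le_div_iff₀ (by positivity) (by norm_num)]
      nlinarith
    linarith
  ext x
  obtain ⟨i, hi, hxi⟩ := ht' x
  have h1 : localRep i s x = 0 :=
    norm_le_zero_iff.1 ((hbound i hi x (hHK i hxi)).trans hM0)
  have := eq_zero_of_localRep i s (hKb i (hHK i hxi)) h1
  simpa using this

end Sections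

section Algebra

/-- Pull-back of an inner product under an injective linear map. -/
@[reducible]
def coreOfInjective {V W : Type*} [NormedAddCommGroup V] [InnerProductSpace ℂ V] [AddCommGroup W]
    [Module ℂ W] (σ : W →ₗ[ℂ] V) (hσ : Function.Injective σ) : InnerProductSpace.Core ℂ W where
  inner v w := inner ℂ (σ v) (σ w)
  conj_inner_symm _ _ := inner_conj_symm _ _
  re_inner_nonneg _ := inner_self_nonneg
  add_left u v w := by rw [map_add, inner_add_left]
  smul_left v w c := by rw [map_smul, inner_smul_left]
  definite v h := hσ (by rw [map_zero]; exact inner_self_eq_zero.1 h)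

/-- The quotient inner product `c` under a surjection `A` satisfies `∑ c(A sᵢ, w) A sᵢ = w` for each
orthonormal basis `s`. -/
theorem exists_quotientCore {V W : Type*} [NormedAddCommGroup V] [InnerProductSpace ℂ V]
    [FiniteDimensional ℂ V] [AddCommGroup W] [Module ℂ W] (A : V →ₗ[ℂ] W)
    (hA : Function.Surjective A) :
    ∃ c : InnerProductSpace.Core ℂ W, ∀ {ι : Type} [Fintype ι] (s : OrthonormalBasis ι ℂ V) (w : W),
      ∑ i, c.inner (A (s i)) w • A (s i) = w := by
  set K := LinearMap.ker A with hK
  have hbij : Function.Bijective (A.domRestrict Kᗮ) := by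
    constructor
    · rw [← LinearMap.ker_eq_bot, LinearMap.ker_eq_bot']
      rintro ⟨u, hu⟩ h
      have h1 : u ∈ K := h
      have h2 : inner ℂ u u = 0 := (Submodule.mem_orthogonal K u).1 hu u h1
      exact Subtype.ext (inner_self_eq_zero.1 h2)
    · intro w
      obtain ⟨v, rfl⟩ := hA w
      refine ⟨⟨v - K.starProjection v, K.sub_starProjection_mem_orthogonal v⟩, ?_⟩
      rw [LinearMap.domRestrict_apply, map_sub]
      have : A (K.starProjection v) = 0 := K.starProjection_apply_mem v
      rw [this, sub_zero]
  set σ' := (LinearEquiv.ofBijective _ hbij).symm with hσ'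
  have hσA : ∀ w, A (σ' w : V) = w := fun w => (LinearEquiv.ofBijective _ hbij).apply_symm_apply w
  set σ : W →ₗ[ℂ] V := Kᗮ.subtype ∘ₗ σ'.toLinearMap with hσ
  have hσinj : Function.Injective σ := Subtype.val_injective.comp σ'.injective
  refine ⟨coreOfInjective σ hσinj, fun s w => ?_⟩
  have h1 : ∀ v w, (coreOfInjective σ hσinj).inner (A v) w = inner ℂ v (σ w) := by
    intro v w
    change inner ℂ (σ (A v)) (σ w) = _
    have h2 : σ (A v) - v ∈ K := by
      rw [hK, LinearMap.mem_ker, map_sub, sub_eq_zero]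
      exact hσA _
    have h3 : inner ℂ (σ (A v) - v) (σ w) = 0 :=
      (Submodule.mem_orthogonal K _).1 (σ' w).2 _ h2
    rwa [inner_sub_left, sub_eq_zero] at h3
  simp_rw [h1]
  calc ∑ i, inner ℂ (s i) (σ w) • A (s i) = A (∑ i, inner ℂ (s i) (σ w) • s i) := by
        rw [map_sum]; simp_rw [map_smul]
    _ = A (σ w) := by rw [s.sum_repr' (σ w)]
    _ = w := hσA w

theorem core_inner_sum_right {W : Type*} [AddCommGroup W] [Module ℂ W]
    (c : InnerProductSpace.Core ℂ W) {ι : Type} (t : Finset ι) (v : W) (a : ι → ℂ) (f : ι → W) :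
    c.inner v (∑ i ∈ t, a i • f i) = ∑ i ∈ t, a i * c.inner v (f i) := by
  let _ := c.toNormedAddCommGroup
  let _ := InnerProductSpace.ofCore c.toCore
  change inner ℂ v (∑ i ∈ t, a i • f i) = ∑ i ∈ t, a i * inner ℂ v (f i)
  rw [inner_sum]
  simp_rw [inner_smul_right]

theorem core_inner_sum_left {W : Type*} [AddCommGroup W] [Module ℂ W]
    (c : InnerProductSpace.Core ℂ W) {ι : Type} (t : Finset ι) (v : W) (a : ι → ℂ) (f : ι → W) :
    c.inner (∑ i ∈ t, a i • f i) v = ∑ i ∈ t, (starRingEnd ℂ) (a i) * c.inner (f i) v := by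
  let _ := c.toNormedAddCommGroup
  let _ := InnerProductSpace.ofCore c.toCore
  change inner ℂ (∑ i ∈ t, a i • f i) v = ∑ i ∈ t, (starRingEnd ℂ) (a i) * inner ℂ (f i) v
  rw [sum_inner]
  simp_rw [inner_smul_left]

theorem core_unique {W : Type*} [AddCommGroup W] [Module ℂ W] {ι : Type} [Fintype ι]
    (c c' : InnerProductSpace.Core ℂ W) (s : ι → W)
    (hc : ∀ w, ∑ i, c.inner (s i) w • s i = w) (hc' : ∀ w, ∑ i, c'.inner (s i) w • s i = w) :
    c = c' := by
  have h : ∀ v w, c.inner v w = c'.inner v w := by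
    intro v w
    calc c.inner v w = c.inner v (∑ i, c'.inner (s i) w • s i) := by rw [hc']
      _ = ∑ i, c'.inner (s i) w * c.inner v (s i) := core_inner_sum_right ..
      _ = ∑ i, (starRingEnd ℂ) (c.inner (s i) v) * c'.inner (s i) w := by
        refine Finset.sum_congr rfl fun i _ => ?_
        rw [c.conj_inner_symm, mul_comm]
      _ = c'.inner (∑ i, c.inner (s i) v • s i) w := (core_inner_sum_left ..).symm
      _ = c'.inner v w := by rw [hc]
  obtain ⟨⟨⟨i⟩, _, _, _, _⟩, _⟩ := c
  obtain ⟨⟨⟨i'⟩, _, _, _, _⟩, _⟩ := c'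
  have : i = i' := by funext v w; exact h v w
  subst this
  rfl

/-- A basis orthonormal for the inner product `H`. -/
def IsOrthonormalFor {V : Type*} [AddCommGroup V] [Module ℂ V] (H : InnerProductSpace.Core ℂ V)
    {ι : Type} [DecidableEq ι] (s : Module.Basis ι ℂ V) : Prop :=
  ∀ i j, H.inner (s i) (s j) = if i = j then 1 else 0

theorem exists_isOrthonormalFor {V : Type*} [AddCommGroup V] [Module ℂ V] [FiniteDimensional ℂ V]
    (H : InnerProductSpace.Core ℂ V) :
    ∃ s : Module.Basis (Fin (Module.finrank ℂ V)) ℂ V, IsOrthonormalFor H s := by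
  let _ := H.toNormedAddCommGroup
  let _ := InnerProductSpace.ofCore H.toCore
  refine ⟨(stdOrthonormalBasis ℂ V).toBasis, fun i j => ?_⟩
  have := orthonormal_iff_ite.1 (stdOrthonormalBasis ℂ V).orthonormal i j
  rw [OrthonormalBasis.coe_toBasis]
  exact this

theorem exists_quotientCore' {V W : Type*} [AddCommGroup V] [Module ℂ V]
    [FiniteDimensional ℂ V] [AddCommGroup W] [Module ℂ W] (H : InnerProductSpace.Core ℂ V)
    (A : V →ₗ[ℂ] W) (hA : Function.Surjective A) :
    ∃ c : InnerProductSpace.Core ℂ W, ∀ s : Module.Basis (Fin (Module.finrank ℂ V)) ℂ V,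
      IsOrthonormalFor H s → ∀ w : W, ∑ i, c.inner (A (s i)) w • A (s i) = w := by
  let _ := H.toNormedAddCommGroup
  let _ := InnerProductSpace.ofCore H.toCore
  obtain ⟨c, hc⟩ := exists_quotientCore A hA
  refine ⟨c, fun s hs w => ?_⟩
  have ho : Orthonormal ℂ s := orthonormal_iff_ite.2 hs
  simpa using hc (s.toOrthonormalBasis ho) w

end Algebra

section Metrics

variable {n r : ℕ} {X : Type*} [TopologicalSpace X] [ChartedSpace (Fin n → ℂ) X]
  {E : X → Type*} [∀ x, AddCommGroup (E x)] [∀ x, Module ℂ (E x)] [∀ x, TopologicalSpace (E x)]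
  [TopologicalSpace (TotalSpace (Fin r → ℂ) E)] [FiberBundle (Fin r → ℂ) E]

variable (r E) in
/-- The `j`-th member of the holomorphic frame of `E` given by the preferred trivialization at
`x₀`. -/
def frame (x₀ : X) (j : Fin r) (x : X) : E x :=
  (trivializationAt (Fin r → ℂ) E x₀).symm x (Pi.single j 1)

variable (n r E) in
/-- The space `K` of (smooth) Hermitian metrics on `E`. Following Mathlib, inner products are
conjugate-linear in the first variable. -/
@[ext]
structure HermitianMetric where
  core : ∀ x, InnerProductSpace.Core ℂ (E x)
  smooth : ∀ (x₀ : X) (j k : Fin r), ContMDiffOn 𝓘(ℝ, Fin n → ℂ) 𝓘(ℝ, ℂ) ∞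
    (fun x => (core x).inner (frame r E x₀ j x) (frame r E x₀ k x))
    (trivializationAt (Fin r → ℂ) E x₀).baseSet

variable (n r E) in
/-- Every fibre of `E` is spanned by the values of global holomorphic sections. -/
def IsGloballyGenerated : Prop :=
  ∀ (x : X) (v : E x), ∃ s : HolSection n r E, s x = v

/-- The Gram matrix of `h` at `x` in the frame at `x₀`. -/
def HermitianMetric.gram (h : HermitianMetric n r E) (x₀ x : X) : Matrix (Fin r) (Fin r) ℂ :=
  Matrix.of fun j k => (h.core x).inner (frame r E x₀ j x) (frame r E x₀ k x)

/-- `log det (h₀⁻¹ h)` at the point `x`: the function `tr φ` if `h = e ^ φ h₀`. -/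
def logDetRel (h₀ h : HermitianMetric n r E) (x : X) : ℝ :=
  Real.log ((h.gram x x).det / (h₀.gram x x).det).re

variable [VectorBundle ℂ (Fin r → ℂ) E]

theorem section_eq_sum_frame (x₀ : X) (s : HolSection n r E) {x : X}
    (hx : x ∈ (trivializationAt (Fin r → ℂ) E x₀).baseSet) :
    s x = ∑ j, localRep x₀ s x j • frame r E x₀ j x := by
  set ε := (trivializationAt (Fin r → ℂ) E x₀).linearEquivAt ℂ x hx with hε
  have h1 : ε (s x) = localRep x₀ s x := rfl
  have h2 : ∀ j, frame r E x₀ j x = ε.symm (Pi.single j 1) := fun j => rfl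
  simp_rw [h2, ← map_smul, ← map_sum]
  rw [← ε.symm_apply_apply (s x), h1]
  congr 1
  ext i
  simp [Finset.sum_apply, Pi.single_apply]

theorem frame_coeff (x₀ : X) {x : X}
    (hx : x ∈ (trivializationAt (Fin r → ℂ) E x₀).baseSet) (a b : Fin r → ℂ)
    (h : ∑ j, a j • frame r E x₀ j x = ∑ j, b j • frame r E x₀ j x) : a = b := by
  set ε := (trivializationAt (Fin r → ℂ) E x₀).linearEquivAt ℂ x hx with hε
  have h2 : ∀ j, frame r E x₀ j x = ε.symm (Pi.single j 1) := fun j => rfl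
  have h3 : ∀ a : Fin r → ℂ, ∑ j, a j • frame r E x₀ j x = ε.symm a := fun a => by
    simp_rw [h2, ← map_smul, ← map_sum]
    congr 1
    ext i
    simp [Finset.sum_apply, Pi.single_apply]
  rw [h3, h3] at h
  exact ε.symm.injective h

variable [ContMDiffVectorBundle ω (Fin r → ℂ) E 𝓘(ℂ, Fin n → ℂ)]

/-- The pointwise inner product of two holomorphic sections is continuous. -/
theorem continuous_inner_section (h : HermitianMetric n r E) (s t : HolSection n r E) :
    Continuous fun x => (h.core x).inner (s x) (t x) := by
  rw [continuous_iff_continuousAt]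
  intro x₀
  have hx₀ : x₀ ∈ (trivializationAt (Fin r → ℂ) E x₀).baseSet :=
    FiberBundle.mem_baseSet_trivializationAt' x₀
  have hB := (trivializationAt (Fin r → ℂ) E x₀).open_baseSet
  have hs := (contMDiffOn_localRep x₀ s).continuousOn
  have ht := (contMDiffOn_localRep x₀ t).continuousOn
  have key : ContinuousOn (fun x => ∑ k, localRep x₀ t x k * ∑ j, (starRingEnd ℂ)
      (localRep x₀ s x j) * (h.core x).inner (frame r E x₀ j x) (frame r E x₀ k x))
      (trivializationAt (Fin r → ℂ) E x₀).baseSet := by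
    refine continuousOn_finsetSum _ fun k _ => ((continuous_apply k).comp_continuousOn ht).mul ?_
    refine continuousOn_finsetSum _ fun j _ => ContinuousOn.mul ?_ (h.smooth x₀ j k).continuousOn
    exact Complex.continuous_conj.comp_continuousOn ((continuous_apply j).comp_continuousOn hs)
  refine (key.congr fun x hx => ?_).continuousAt (hB.mem_nhds hx₀)
  rw [section_eq_sum_frame x₀ t hx, core_inner_sum_right]
  refine Finset.sum_congr rfl fun k _ => ?_
  rw [section_eq_sum_frame x₀ s hx, core_inner_sum_left]

variable [IsManifold 𝓘(ℂ, Fin n → ℂ) ω X]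

theorem contMDiffAt_real_localRep (x₀ : X) (s : HolSection n r E) {x : X}
    (hx : x ∈ (trivializationAt (Fin r → ℂ) E x₀).baseSet) :
    ContMDiffAt 𝓘(ℝ, Fin n → ℂ) 𝓘(ℝ, Fin r → ℂ) ∞ (localRep x₀ s) x := by
  rw [contMDiffAt_iff]
  refine ⟨(contMDiffOn_localRep x₀ s).continuousOn.continuousAt
    ((trivializationAt (Fin r → ℂ) E x₀).open_baseSet.mem_nhds hx), ?_⟩
  have h1 := ((contDiffOn_localRep x₀ x s).restrict_scalars ℝ).of_le (m := ∞) le_top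
  have h2 := (h1.contDiffAt (x := chartAt (Fin n → ℂ) x x)
    (((chartAt (Fin n → ℂ) x).isOpen_inter_preimage_symm
      (trivializationAt (Fin r → ℂ) E x₀).open_baseSet).mem_nhds ⟨mem_chart_target _ x, by
        rw [Set.mem_preimage, (chartAt (Fin n → ℂ) x).left_inv (mem_chart_source _ x)]
        exact hx⟩)).contDiffWithinAt (s := Set.range 𝓘(ℝ, Fin n → ℂ))
  exact h2

variable [CompactSpace X] [T2Space X]

/-- `h = FS(H)`, i.e. `∑ sᵢ ⊗ sᵢ^{*_h} = I` for `H`-orthonormal bases `s₁, …, s_N` of `H⁰(X, E)`,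
where `s ⊗ s^{*_h}` is the endomorphism `v ↦ h(v, s) s`. -/
def IsFubiniStudy (H : InnerProductSpace.Core ℂ (HolSection n r E))
    (h : HermitianMetric n r E) : Prop :=
  ∀ s : Module.Basis (Fin (Module.finrank ℂ (HolSection n r E))) ℂ (HolSection n r E),
    IsOrthonormalFor H s → ∀ (x : X) (v : E x), ∑ i, (h.core x).inner (s i x) v • s i x = v

/-- The entry `((a aᴴ)⁻¹)_{jk}`, as a function of the matrix `a`, is smooth where it is defined. -/
theorem contDiffAt_inv_gram {N : ℕ} (j k : Fin r) (a : Fin N → Fin r → ℂ)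
    (ha : (Matrix.of fun l m => ∑ i, a i l * (starRingEnd ℂ) (a i m) :
      Matrix (Fin r) (Fin r) ℂ).det ≠ 0) :
    ContDiffAt ℝ ∞ (fun a : Fin N → Fin r → ℂ => (Matrix.of fun l m =>
      ∑ i, a i l * (starRingEnd ℂ) (a i m) : Matrix (Fin r) (Fin r) ℂ)⁻¹ j k) a := by
  have hdet : ∀ G : (Fin N → Fin r → ℂ) → Matrix (Fin r) (Fin r) ℂ,
      (∀ l m, ContDiff ℝ ∞ fun a => G a l m) → ContDiff ℝ ∞ fun a => (G a).det := by
    intro G hG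
    simp only [Matrix.det_apply]
    refine ContDiff.sum fun σ _ => ?_
    have : ContDiff ℝ ∞ fun a => ∏ i, G a (σ i) i := contDiff_prod fun i _ => hG _ _
    simpa only [Units.smul_def, zsmul_eq_mul] using contDiff_const.mul this
  have hentry : ∀ l m, ContDiff ℝ ∞ fun a : Fin N → Fin r → ℂ => (Matrix.of fun l m =>
      ∑ i, a i l * (starRingEnd ℂ) (a i m) : Matrix (Fin r) (Fin r) ℂ) l m := by
    intro l m
    simp only [Matrix.of_apply]
    refine ContDiff.sum fun i _ => ?_
    refine (contDiff_apply_apply ℝ ℂ i l).mul ?_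
    exact Complex.conjCLE.contDiff.comp (contDiff_apply_apply ℝ ℂ i m)
  simp only [Matrix.inv_def, Matrix.smul_apply, smul_eq_mul, Ring.inverse_eq_inv']
  refine ((hdet _ hentry).contDiffAt.inv ha).mul (ContDiff.contDiffAt ?_)
  simp only [Matrix.adjugate_apply]
  refine hdet _ fun l m => ?_
  by_cases hl : l = k
  · subst hl
    simp only [Matrix.updateRow_self]
    exact contDiff_const
  · simp only [Matrix.updateRow_ne hl]
    exact hentry l m

/-- The Fubini-Study metric of `H` exists and is unique. -/
theorem existsUnique_fubiniStudy (hE : IsGloballyGenerated n r E)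
    (H : InnerProductSpace.Core ℂ (HolSection n r E)) :
    ∃! h : HermitianMetric n r E, IsFubiniStudy H h := by
  let ev : ∀ x, HolSection n r E →ₗ[ℂ] E x := fun x =>
    { toFun := fun s => s x, map_add' := fun _ _ => rfl, map_smul' := fun _ _ => rfl }
  have hev : ∀ x, Function.Surjective (ev x) := fun x v => hE x v
  choose c hc using fun x => exists_quotientCore' H (ev x) (hev x)
  obtain ⟨s, hs⟩ := exists_isOrthonormalFor H
  refine ⟨⟨c, fun x₀ j k x hx => ?_⟩, fun s hs x v => hc x s hs v, ?_⟩
  · set a : X → Fin (Module.finrank ℂ (HolSection n r E)) → Fin r → ℂ :=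
      fun x i => localRep x₀ (s i) x with ha
    set G : X → Matrix (Fin r) (Fin r) ℂ := fun x =>
      Matrix.of fun l m => ∑ i, a x i l * (starRingEnd ℂ) (a x i m) with hG
    set M : X → Matrix (Fin r) (Fin r) ℂ := fun x =>
      Matrix.of fun j k => (c x).inner (frame r E x₀ j x) (frame r E x₀ k x) with hM
    have hGM : ∀ x ∈ (trivializationAt (Fin r → ℂ) E x₀).baseSet, G x * M x = 1 := by
      intro x hx
      ext l m
      have h1 := hc x s hs (frame r E x₀ m x)
      have hsx : ∀ i, ev x (s i) = ∑ j, a x i j • frame r E x₀ j x :=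
        fun i => section_eq_sum_frame x₀ (s i) hx
      have h2 : ∑ l, (∑ i, (c x).inner (ev x (s i)) (frame r E x₀ m x) * a x i l) •
          frame r E x₀ l x = ∑ l, (Pi.single m 1 : Fin r → ℂ) l • frame r E x₀ l x := by
        have h3 : ∑ l, (Pi.single m 1 : Fin r → ℂ) l • frame r E x₀ l x = frame r E x₀ m x := by
          simp [Pi.single_apply]
        rw [h3]
        conv_rhs => rw [← h1]
        simp_rw [Finset.sum_smul]
        rw [Finset.sum_comm]
        refine Finset.sum_congr rfl fun i _ => ?_
        conv_rhs => rw [hsx i]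
        rw [Finset.smul_sum, ← hsx i]
        simp_rw [mul_smul]
      have h4 := congrFun (frame_coeff x₀ hx _ _ h2) l
      rw [Matrix.mul_apply, Matrix.one_apply]
      have h5 : ∑ j, G x l j * M x j m =
          ∑ i, (c x).inner (ev x (s i)) (frame r E x₀ m x) * a x i l := by
        simp only [hG, hM, Matrix.of_apply, Finset.sum_mul]
        rw [Finset.sum_comm]
        refine Finset.sum_congr rfl fun i _ => ?_
        rw [hsx i, core_inner_sum_left, Finset.sum_mul]
        refine Finset.sum_congr rfl fun j _ => ?_
        ring
      rw [h5, h4, Pi.single_apply]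
    have hdet : (G x).det ≠ 0 := by
      intro h0
      have := congrArg Matrix.det (hGM x hx)
      rw [Matrix.det_mul, h0, zero_mul, Matrix.det_one] at this
      exact zero_ne_one this
    have hsm : ContMDiffAt 𝓘(ℝ, Fin n → ℂ)
        𝓘(ℝ, Fin (Module.finrank ℂ (HolSection n r E)) → Fin r → ℂ) ∞ a x :=
      contMDiffAt_pi_space.2 fun i => contMDiffAt_real_localRep x₀ (s i) hx
    have h6 : ContMDiffAt 𝓘(ℝ, Fin n → ℂ) 𝓘(ℝ, ℂ) ∞ (fun x => (G x)⁻¹ j k) x :=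
      (contDiffAt_inv_gram j k (a x) hdet).comp_contMDiffAt hsm
    refine (h6.congr_of_eventuallyEq ?_).contMDiffWithinAt
    filter_upwards [(trivializationAt (Fin r → ℂ) E x₀).open_baseSet.mem_nhds hx] with y hy
    rw [Matrix.inv_eq_right_inv (hGM y hy)]
    rfl
  · intro h' hh'
    ext1
    funext x
    exact core_unique _ _ (fun i => s i x) (fun v => hh' s hs x v) (fun v => hc x s hs v)

/-- The map `FS : M → K`. -/
def fubiniStudy (hE : IsGloballyGenerated n r E)
    (H : InnerProductSpace.Core ℂ (HolSection n r E)) : HermitianMetric n r E :=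
  (existsUnique_fubiniStudy hE H).choose

theorem isFubiniStudy_fubiniStudy (hE : IsGloballyGenerated n r E)
    (H : InnerProductSpace.Core ℂ (HolSection n r E)) :
    IsFubiniStudy H (fubiniStudy hE H) :=
  (existsUnique_fubiniStudy hE H).choose_spec.1

variable [MeasurableSpace X] [BorelSpace X]

theorem integrable_inner_section (κ : KahlerForm n X) (h : HermitianMetric n r E)
    (s t : HolSection n r E) :
    Integrable (fun x => (h.core x).inner (s x) (t x)) κ.volume :=
  (continuous_inner_section h s t).integrable_of_hasCompactSupport
    (HasCompactSupport.of_compactSpace _)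

theorem re_integral_inner_section (κ : KahlerForm n X) (h : HermitianMetric n r E)
    (s : HolSection n r E) :
    (∫ x, (h.core x).inner (s x) (s x) ∂κ.volume).re =
      ∫ x, ((h.core x).inner (s x) (s x)).re ∂κ.volume :=
  (integral_re (integrable_inner_section κ h s s)).symm

/-- The map `Hilb : K → M`,
`⟨s, t⟩_{Hilb(h)} = N / (V r) * ∫ ⟨s(x), t(x)⟩_h κ ^ n / n!`. -/
@[reducible]
def hilb (κ : KahlerForm n X) (h : HermitianMetric n r E) :
    InnerProductSpace.Core ℂ (HolSection n r E) where
  inner s t := ((Module.finrank ℂ (HolSection n r E) / (κ.totalVolume * r) : ℝ) : ℂ) *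
    ∫ x, (h.core x).inner (s x) (t x) ∂κ.volume
  conj_inner_symm s t := by
    rw [map_mul, Complex.conj_ofReal, ← integral_conj]
    simp_rw [(h.core _).conj_inner_symm]
  re_inner_nonneg s := by
    have h1 : 0 ≤ (∫ x, (h.core x).inner (s x) (s x) ∂κ.volume).re := by
      rw [re_integral_inner_section]
      exact integral_nonneg fun x => (h.core x).re_inner_nonneg (s x)
    have h2 : 0 ≤ (Module.finrank ℂ (HolSection n r E) / (κ.totalVolume * r) : ℝ) :=
      div_nonneg (Nat.cast_nonneg _) (mul_nonneg measureReal_nonneg (Nat.cast_nonneg _))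
    change 0 ≤ (_ * _ : ℂ).re
    rw [Complex.re_ofReal_mul]
    exact mul_nonneg h2 h1
  add_left s t u := by
    rw [← mul_add, ← integral_add (integrable_inner_section κ h s u)
      (integrable_inner_section κ h t u)]
    congr 2
    funext x
    exact (h.core x).add_left _ _ _
  smul_left s t c := by
    rw [mul_left_comm, ← integral_const_mul ((starRingEnd ℂ) c)]
    congr 2
    funext x
    exact (h.core x).smul_left _ _ _
  definite s hs := by
    by_contra hne
    obtain ⟨x, hx⟩ : ∃ x, s x ≠ 0 := by
      by_contra! hall
      exact hne (ContMDiffSection.ext hall)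
    have hr : r ≠ 0 := by
      rintro rfl
      refine hx (eq_zero_of_localRep x s (FiberBundle.mem_baseSet_trivializationAt' x) ?_)
      exact Subsingleton.elim _ _
    have hN : Module.finrank ℂ (HolSection n r E) ≠ 0 :=
      (Module.finrank_pos_iff_exists_ne_zero.2 ⟨s, hne⟩).ne'
    have hV : κ.totalVolume ≠ 0 := by
      have : Nonempty X := ⟨x⟩
      exact (ENNReal.toReal_pos (isOpen_univ.measure_pos κ.volume Set.univ_nonempty).ne'
        (measure_ne_top _ _)).ne'
    have hpos : 0 < (∫ x, (h.core x).inner (s x) (s x) ∂κ.volume).re := by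
      rw [re_integral_inner_section]
      refine Continuous.integral_pos_of_hasCompactSupport_nonneg_nonzero (x := x)
        (Complex.continuous_re.comp (continuous_inner_section h s s))
        (HasCompactSupport.of_compactSpace _) (fun y => (h.core y).re_inner_nonneg (s y)) ?_
      intro h0
      refine hx ((h.core x).definite _ ?_)
      have him : ((h.core x).inner (s x) (s x)).im = 0 :=
        Complex.conj_eq_iff_im.1 ((h.core x).conj_inner_symm _ _)
      exact Complex.ext h0 him
    rcases mul_eq_zero.1 hs with h0 | h0
    · rw [Complex.ofReal_eq_zero, div_eq_zero_iff] at h0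
      rcases h0 with h0 | h0
      · exact hN (Nat.cast_eq_zero.1 h0)
      · exact (mul_ne_zero hV (Nat.cast_ne_zero.2 hr)) h0
    · rw [h0] at hpos
      exact lt_irrefl _ hpos

/-- The operator `T = Hilb ∘ FS : M → M`. -/
@[reducible]
def tOperator (κ : KahlerForm n X) (hE : IsGloballyGenerated n r E)
    (H : InnerProductSpace.Core ℂ (HolSection n r E)) :
    InnerProductSpace.Core ℂ (HolSection n r E) :=
  hilb κ (fubiniStudy hE H)

/-- `log det : M → ℝ` with respect to `Θ = θ₁ ∧ ⋯ ∧ θ_N`, i.e. `log det [H(θ_i, θ_j)]`. -/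
def logDet {ι : Type} [Fintype ι] [DecidableEq ι] {V : Type*} [AddCommGroup V] [Module ℂ V]
    (θ : Module.Basis ι ℂ V) (H : InnerProductSpace.Core ℂ V) : ℝ :=
  Real.log (Matrix.of fun i j => H.inner (θ i) (θ j)).det.re

/-- The functional `I : K → ℝ` normalized by `I(h₀) = 0`: if `h = e ^ φ h₀`, then
`I(h) = ∫ tr φ dVol`, so that `dI/dt = ∫ tr(dφ/dt) dVol` along `h_t = e ^ {φ_t} h₀`. -/
def functionalI (κ : KahlerForm n X) (h₀ h : HermitianMetric n r E) : ℝ :=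
  ∫ x, logDetRel h₀ h x ∂κ.volume

/-- `Z = -I ∘ FS : M → ℝ`. -/
def functionalZ (κ : KahlerForm n X) (hE : IsGloballyGenerated n r E)
    (h₀ : HermitianMetric n r E) (H : InnerProductSpace.Core ℂ (HolSection n r E)) : ℝ :=
  -functionalI κ h₀ (fubiniStudy hE H)

/-- `Z̃ = Z + (r V / N) log det : M → ℝ`. -/
def functionalZTilde (κ : KahlerForm n X) (hE : IsGloballyGenerated n r E)
    (h₀ : HermitianMetric n r E)
    (θ : Module.Basis (Fin (Module.finrank ℂ (HolSection n r E))) ℂ (HolSection n r E))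
    (H : InnerProductSpace.Core ℂ (HolSection n r E)) : ℝ :=
  functionalZ κ hE h₀ H +
    (r * κ.totalVolume / Module.finrank ℂ (HolSection n r E)) * logDet θ H

end Metrics

end

end BalancedMetrics

/-!
Everything rests on the inequality `log det A ≤ tr A - dim` for positive definite `A`, applied to
one inner product relative to another (`log_det_coreGram_sub_le`). The relative trace of `c` with
respect to `c'` is `∑ c(sᵢ, sᵢ)` for any family with `∑ sᵢ ⊗ sᵢ^{*_{c'}} = I`, which need not be a
basis (`sum_inner_eq_trace`).

For `log det`, take `c = T(H)`, `c' = H` and `s` an `H`-orthonormal basis of sections. By the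
definition of `FS(H)`, the function `∑ |sᵢ|²` for the metric `FS(H)` is constantly `r`, so the trace
of `T(H)` relative to `H` is at most `N`, and `log det T(H) - log det H ≤ 0`
(`logDet_tOperator_le`).

For `Z`, work in each fibre with `c = FS(H)`, `c' = FS(T(H))` and the values of a `T(H)`-orthonormal
basis `s` of sections, which satisfies the identity above by the definition of `FS(T(H))`. Since
`T(H) = Hilb(FS(H))`, integrating `∑ |sᵢ|²` for the metric `FS(H)` gives `r V` when `N > 0`, so the
integral of `log det` of `FS(H)` relative to `FS(T(H))` is at most `r V - r V = 0`
(`functionalI_fubiniStudy_le`). To split this integral into a difference of two values of `I`, the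
integrands have to be integrable, which follows from their continuity (`continuous_logDetRel`).

The inequality for `Z̃` is a combination of the other two with nonnegative coefficients.
-/

namespace BalancedMetrics

/-! ### Gram matrices -/

section Gram

open scoped ComplexOrder Matrix

/-- The Gram matrix `[c(eᵢ, eⱼ)]` of a family of vectors for the inner product `c`. -/
def coreGram {W ι : Type*} [AddCommGroup W] [Module ℂ W] (c : InnerProductSpace.Core ℂ W)
    (e : ι → W) : Matrix ι ι ℂ :=
  Matrix.of fun i j => c.inner (e i) (e j)

theorem log_re_det_le_trace_sub_card {ι : Type*} [Fintype ι] [DecidableEq ι]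
    {A : Matrix ι ι ℂ} (hA : A.PosDef) :
    Real.log A.det.re ≤ A.trace.re - Fintype.card ι := by
  have hdet : A.det.re = ∏ i, hA.isHermitian.eigenvalues i := by
    rw [hA.isHermitian.det_eq_prod_eigenvalues]
    exact_mod_cast Complex.ofReal_re (∏ i, hA.isHermitian.eigenvalues i)
  have htr : A.trace.re = ∑ i, hA.isHermitian.eigenvalues i := by
    rw [hA.isHermitian.trace_eq_sum_eigenvalues]
    exact_mod_cast Complex.ofReal_re (∑ i, hA.isHermitian.eigenvalues i)
  have hcard : (Fintype.card ι : ℝ) = ∑ _i : ι, 1 := by simp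
  rw [hdet, htr, Real.log_prod fun i _ => (hA.eigenvalues_pos i).ne', hcard,
    ← Finset.sum_sub_distrib]
  exact Finset.sum_le_sum fun i _ => Real.log_le_sub_one_of_pos (hA.eigenvalues_pos i)

variable {W : Type*} [AddCommGroup W] [Module ℂ W]

theorem posDef_coreGram {ι : Type*} [Finite ι] (c : InnerProductSpace.Core ℂ W)
    (e : Module.Basis ι ℂ W) : (coreGram c e).PosDef := by
  let _ := c.toNormedAddCommGroup
  let _ := InnerProductSpace.ofCore c.toCore
  exact Matrix.posDef_gram_of_linearIndependent e.linearIndependent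

theorem det_coreGram_eq_ofReal_and_pos {ι : Type*} [Fintype ι] [DecidableEq ι]
    (c : InnerProductSpace.Core ℂ W) (e : Module.Basis ι ℂ W) :
    (coreGram c e).det = ((coreGram c e).det.re : ℂ) ∧ 0 < (coreGram c e).det.re := by
  have h := Complex.lt_def.1 (posDef_coreGram c e).det_pos
  exact ⟨Complex.ext rfl (by simpa using h.2.symm), h.1⟩

theorem coreGram_eq_conjTranspose_mul_mul {ι κ : Type} [Fintype κ]
    (c : InnerProductSpace.Core ℂ W) (u : κ → W) (e : ι → W) (P : Matrix κ ι ℂ)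
    (he : ∀ i, e i = ∑ k, P k i • u k) :
    coreGram c e = Pᴴ * coreGram c u * P := by
  ext i j
  simp only [coreGram, Matrix.of_apply, Matrix.mul_apply, Matrix.conjTranspose_apply]
  rw [he j, core_inner_sum_right]
  refine Finset.sum_congr rfl fun k _ => ?_
  rw [he i, core_inner_sum_left, mul_comm]
  rfl

/-- The ratio of the Gram determinants of two inner products does not depend on the basis. -/
theorem det_coreGram_mul_det_coreGram {ι : Type} [Fintype ι] [DecidableEq ι]
    (c c' : InnerProductSpace.Core ℂ W) (e u : Module.Basis ι ℂ W) :
    (coreGram c e).det * (coreGram c' u).det = (coreGram c u).det * (coreGram c' e).det := by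
  have he : ∀ i, e i = ∑ k, u.toMatrix e k i • u k := fun i => (u.sum_toMatrix_smul_self e i).symm
  rw [coreGram_eq_conjTranspose_mul_mul c u e _ he, coreGram_eq_conjTranspose_mul_mul c' u e _ he]
  simp only [Matrix.det_mul]
  ring

theorem sum_inner_smul_of_isOrthonormalFor {ι : Type} [Fintype ι] [DecidableEq ι]
    {c : InnerProductSpace.Core ℂ W} {u : Module.Basis ι ℂ W} (hu : IsOrthonormalFor c u) (w : W) :
    ∑ i, c.inner (u i) w • u i = w := by
  conv_rhs => rw [← u.sum_repr w]
  refine Finset.sum_congr rfl fun k _ => ?_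
  congr 1
  conv_lhs => rw [← u.sum_repr w]
  rw [core_inner_sum_right]
  simp [hu k]

/-- If `∑ sᵢ ⊗ sᵢ^{*_{c'}} = I`, then `∑ c(sᵢ, sᵢ)` is the trace of `c` relative to `c'`. -/
theorem sum_inner_eq_trace {ι κ : Type} [Fintype ι] [DecidableEq ι] [Fintype κ]
    (c c' : InnerProductSpace.Core ℂ W) {u : Module.Basis ι ℂ W} (hu : IsOrthonormalFor c' u)
    {s : κ → W} (hs : ∀ w, ∑ i, c'.inner (s i) w • s i = w) :
    ∑ i, c.inner (s i) (s i) = (coreGram c u).trace := by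
  have key : ∀ j k, ∑ i, c'.inner (s i) (u j) * c'.inner (u k) (s i) = if k = j then 1 else 0 := by
    intro j k
    rw [← hu k j]
    conv_rhs => rw [← hs (u j)]
    exact (core_inner_sum_right ..).symm
  have hterm : ∀ i, c.inner (s i) (s i) = ∑ k, ∑ j,
      (c'.inner (s i) (u j) * c'.inner (u k) (s i)) * c.inner (u j) (u k) := by
    intro i
    conv_lhs => rw [← sum_inner_smul_of_isOrthonormalFor hu (s i), core_inner_sum_right]
    refine Finset.sum_congr rfl fun k _ => ?_
    rw [core_inner_sum_left, Finset.mul_sum]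
    refine Finset.sum_congr rfl fun j _ => ?_
    rw [c'.conj_inner_symm]
    ring
  simp_rw [hterm]
  rw [Finset.sum_comm]
  simp_rw [Finset.sum_comm (s := (Finset.univ : Finset κ)), ← Finset.sum_mul, key]
  simp [Matrix.trace, coreGram]

theorem exists_isOrthonormalFor_of_basis {ι : Type} [Fintype ι] [DecidableEq ι]
    (c : InnerProductSpace.Core ℂ W) (e : Module.Basis ι ℂ W) :
    ∃ u : Module.Basis ι ℂ W, IsOrthonormalFor c u := by
  have : FiniteDimensional ℂ W := Module.Finite.of_basis e
  obtain ⟨u, hu⟩ := exists_isOrthonormalFor c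
  refine ⟨u.reindex (Fintype.equivOfCardEq (by simp [Module.finrank_eq_card_basis e])),
    fun i j => ?_⟩
  simp [hu _ _]

theorem sum_inner_self_eq_card {ι κ : Type} [Fintype ι] [DecidableEq ι] [Fintype κ]
    (c : InnerProductSpace.Core ℂ W) (e : Module.Basis ι ℂ W)
    {s : κ → W} (hs : ∀ w, ∑ i, c.inner (s i) w • s i = w) :
    ∑ i, c.inner (s i) (s i) = Fintype.card ι := by
  obtain ⟨u, hu⟩ := exists_isOrthonormalFor_of_basis c e
  rw [sum_inner_eq_trace c c hu hs]
  simp [Matrix.trace, coreGram, hu _ _]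

/-- The inequality `log det ≤ tr - dim` for the inner product `c` relative to `c'`, where the trace
is computed by a family with `∑ sᵢ ⊗ sᵢ^{*_{c'}} = I`. -/
theorem log_det_coreGram_sub_le {ι κ : Type} [Fintype ι] [DecidableEq ι] [Fintype κ]
    (c c' : InnerProductSpace.Core ℂ W) (e : Module.Basis ι ℂ W)
    {s : κ → W} (hs : ∀ w, ∑ i, c'.inner (s i) w • s i = w) :
    Real.log (coreGram c e).det.re - Real.log (coreGram c' e).det.re ≤
      (∑ i, c.inner (s i) (s i)).re - Fintype.card ι := by
  obtain ⟨u, hu⟩ := exists_isOrthonormalFor_of_basis c' e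
  have hone : coreGram c' u = 1 := by
    ext i j
    simp [coreGram, hu i j, Matrix.one_apply]
  have hdet := det_coreGram_mul_det_coreGram c c' e u
  obtain ⟨h1, p1⟩ := det_coreGram_eq_ofReal_and_pos c e
  obtain ⟨h2, p2⟩ := det_coreGram_eq_ofReal_and_pos c' e
  obtain ⟨h3, p3⟩ := det_coreGram_eq_ofReal_and_pos c u
  rw [hone, Matrix.det_one, mul_one, h1, h2, h3, ← Complex.ofReal_mul, Complex.ofReal_inj] at hdet
  rw [hdet, Real.log_mul p3.ne' p2.ne', add_sub_cancel_right, sum_inner_eq_trace c c' hu hs]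
  exact log_re_det_le_trace_sub_card (posDef_coreGram c u)

end Gram

/-! ### The relative determinant of two Hermitian metrics -/

section Relative

variable {n r : ℕ} {X : Type*} [TopologicalSpace X] [ChartedSpace (Fin n → ℂ) X]
  {E : X → Type*} [∀ x, AddCommGroup (E x)] [∀ x, Module ℂ (E x)] [∀ x, TopologicalSpace (E x)]
  [TopologicalSpace (TotalSpace (Fin r → ℂ) E)] [FiberBundle (Fin r → ℂ) E]
  [VectorBundle ℂ (Fin r → ℂ) E]

/-- The members at `x` of the frame given by the trivialization at `x₀`, as a basis of the fibre. -/
noncomputable def frameBasis (x₀ : X) {x : X}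
    (hx : x ∈ (trivializationAt (Fin r → ℂ) E x₀).baseSet) :
    Module.Basis (Fin r) ℂ (E x) :=
  (Pi.basisFun ℂ (Fin r)).map ((trivializationAt (Fin r → ℂ) E x₀).linearEquivAt ℂ x hx).symm

theorem frameBasis_apply (x₀ : X) {x : X}
    (hx : x ∈ (trivializationAt (Fin r → ℂ) E x₀).baseSet) (j : Fin r) :
    frameBasis x₀ hx j = frame r E x₀ j x := by
  rw [frameBasis, Module.Basis.map_apply, Pi.basisFun_apply]
  rfl

theorem gram_eq_coreGram (h : HermitianMetric n r E) (x₀ : X) {x : X}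
    (hx : x ∈ (trivializationAt (Fin r → ℂ) E x₀).baseSet) :
    h.gram x₀ x = coreGram (h.core x) (frameBasis x₀ hx) := by
  ext j k
  simp [HermitianMetric.gram, coreGram, frameBasis_apply]

/-- In the definition of `logDetRel`, the frame centred at `x` may be replaced by any other. -/
theorem logDetRel_eq (h₀ h : HermitianMetric n r E) (x₀ : X) {x : X}
    (hx : x ∈ (trivializationAt (Fin r → ℂ) E x₀).baseSet) :
    logDetRel h₀ h x = Real.log (h.gram x₀ x).det.re - Real.log (h₀.gram x₀ x).det.re := by
  have hx' := FiberBundle.mem_baseSet_trivializationAt' (F := Fin r → ℂ) (E := E) x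
  have hdet := det_coreGram_mul_det_coreGram (h.core x) (h₀.core x) (frameBasis x hx')
    (frameBasis x₀ hx)
  rw [logDetRel, gram_eq_coreGram h x hx', gram_eq_coreGram h₀ x hx', gram_eq_coreGram h x₀ hx,
    gram_eq_coreGram h₀ x₀ hx]
  obtain ⟨h1, p1⟩ := det_coreGram_eq_ofReal_and_pos (h.core x) (frameBasis x₀ hx)
  obtain ⟨h2, p2⟩ := det_coreGram_eq_ofReal_and_pos (h₀.core x) (frameBasis x₀ hx)
  obtain ⟨h3, p3⟩ := det_coreGram_eq_ofReal_and_pos (h₀.core x) (frameBasis x hx')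
  have n2 : (coreGram (h₀.core x) (frameBasis x₀ hx)).det ≠ 0 := by
    rw [h2]; exact Complex.ofReal_ne_zero.2 p2.ne'
  have n3 : (coreGram (h₀.core x) (frameBasis x hx')).det ≠ 0 := by
    rw [h3]; exact Complex.ofReal_ne_zero.2 p3.ne'
  rw [← Real.log_div p1.ne' p2.ne', (div_eq_div_iff n3 n2).2 hdet, h1, h2, ← Complex.ofReal_div,
    Complex.ofReal_re]
  simp

theorem continuous_logDetRel (h₀ h : HermitianMetric n r E) : Continuous (logDetRel h₀ h) := by
  rw [continuous_iff_continuousAt]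
  intro x₀
  set B := (trivializationAt (Fin r → ℂ) E x₀).baseSet
  have hB : B ∈ 𝓝 x₀ := (trivializationAt (Fin r → ℂ) E x₀).open_baseSet.mem_nhds
    (FiberBundle.mem_baseSet_trivializationAt' x₀)
  have hlog : ∀ g : HermitianMetric n r E,
      ContinuousOn (fun x => Real.log (g.gram x₀ x).det.re) B := by
    intro g
    have hg : ContinuousOn (g.gram x₀) B :=
      continuousOn_pi.2 fun j => continuousOn_pi.2 fun k => (g.smooth x₀ j k).continuousOn
    refine ContinuousOn.log (Complex.continuous_re.comp_continuousOn
      ((Continuous.matrix_det continuous_id).comp_continuousOn hg)) fun x hx => ?_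
    rw [gram_eq_coreGram g x₀ hx]
    exact (det_coreGram_eq_ofReal_and_pos _ _).2.ne'
  exact (((hlog h).sub (hlog h₀)).congr fun x hx => logDetRel_eq h₀ h x₀ hx).continuousAt hB

/-- The fibrewise inequality `log det ≤ tr - r` for the metric `h` relative to `h'`. -/
theorem logDetRel_sub_le {κ : Type} [Fintype κ] (h₀ h h' : HermitianMetric n r E) (x : X)
    {s : κ → E x} (hs : ∀ v, ∑ i, (h'.core x).inner (s i) v • s i = v) :
    logDetRel h₀ h x - logDetRel h₀ h' x ≤ (∑ i, (h.core x).inner (s i) (s i)).re - r := by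
  have hx := FiberBundle.mem_baseSet_trivializationAt' (F := Fin r → ℂ) (E := E) x
  rw [logDetRel_eq h₀ h x hx, logDetRel_eq h₀ h' x hx, gram_eq_coreGram h x hx,
    gram_eq_coreGram h' x hx]
  have := log_det_coreGram_sub_le (h.core x) (h'.core x) (frameBasis x hx) hs
  rw [Fintype.card_fin] at this
  linarith

theorem integrable_logDetRel [CompactSpace X] [T2Space X] [MeasurableSpace X] [BorelSpace X]
    (κ : KahlerForm n X) (h₀ h : HermitianMetric n r E) :
    Integrable (logDetRel h₀ h) κ.volume :=
  (continuous_logDetRel h₀ h).integrable_of_hasCompactSupport (HasCompactSupport.of_compactSpace _)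

variable [ContMDiffVectorBundle ω (Fin r → ℂ) E 𝓘(ℂ, Fin n → ℂ)]
  [IsManifold 𝓘(ℂ, Fin n → ℂ) ω X] [CompactSpace X] [T2Space X]

theorem sum_inner_fubiniStudy_eq_rank (hE : IsGloballyGenerated n r E)
    {H : InnerProductSpace.Core ℂ (HolSection n r E)}
    {s : Module.Basis (Fin (Module.finrank ℂ (HolSection n r E))) ℂ (HolSection n r E)}
    (hs : IsOrthonormalFor H s) (x : X) :
    ∑ i, ((fubiniStudy hE H).core x).inner (s i x) (s i x) = r := by
  have hx := FiberBundle.mem_baseSet_trivializationAt' (F := Fin r → ℂ) (E := E) x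
  rw [sum_inner_self_eq_card _ (frameBasis x hx)
    (isFubiniStudy_fubiniStudy hE H s hs x), Fintype.card_fin]

/-! ### The functionals `log det` and `I ∘ FS` under `T` -/

variable [MeasurableSpace X] [BorelSpace X]

theorem sum_hilb_inner (κ : KahlerForm n X) (h : HermitianMetric n r E) {ι : Type} [Fintype ι]
    (s : ι → HolSection n r E) :
    ∑ i, (hilb κ h).inner (s i) (s i) =
      ((Module.finrank ℂ (HolSection n r E) / (κ.totalVolume * r) : ℝ) : ℂ) *
        ∫ x, ∑ i, (h.core x).inner (s i x) (s i x) ∂κ.volume := by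
  rw [integral_finsetSum _ fun i _ => integrable_inner_section κ h (s i) (s i), Finset.mul_sum]
  rfl

/-- The operator `T` does not increase `log det`: the trace of `T(H)` relative to `H` is
`N / (V r)` times the integral of the constant `r`, hence at most `N`. -/
theorem logDet_tOperator_le (κ : KahlerForm n X) (hE : IsGloballyGenerated n r E)
    (θ : Module.Basis (Fin (Module.finrank ℂ (HolSection n r E))) ℂ (HolSection n r E))
    (H : InnerProductSpace.Core ℂ (HolSection n r E)) :
    logDet θ (tOperator κ hE H) ≤ logDet θ H := by
  obtain ⟨s, hs⟩ := exists_isOrthonormalFor H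
  have hle := log_det_coreGram_sub_le (tOperator κ hE H) H θ
    (sum_inner_smul_of_isOrthonormalFor hs)
  have htr : (∑ i, (tOperator κ hE H).inner (s i) (s i)).re ≤
      Module.finrank ℂ (HolSection n r E) := by
    rw [sum_hilb_inner]
    simp_rw [sum_inner_fubiniStudy_eq_rank hE hs]
    rw [integral_const, Complex.re_ofReal_mul, Complex.real_smul, Complex.re_ofReal_mul,
      Complex.natCast_re]
    change _ / _ * (κ.totalVolume * r) ≤ _
    -- If `V r = 0`, the normalizing constant is `N / 0 = 0` and the trace vanishes.
    rcases eq_or_ne (κ.totalVolume * r) 0 with h0 | h0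
    · rw [h0, mul_zero]
      exact Nat.cast_nonneg _
    · exact (div_mul_cancel₀ _ h0).le
  rw [Fintype.card_fin] at hle
  change Real.log (coreGram _ θ).det.re ≤ Real.log (coreGram _ θ).det.re
  linarith

/-- The operator `T` does not decrease `I ∘ FS`: the trace of `FS(H)` relative to `FS(T(H))` has
integral at most `r V`. -/
theorem functionalI_fubiniStudy_le (κ : KahlerForm n X) (hE : IsGloballyGenerated n r E)
    (h₀ : HermitianMetric n r E) (H : InnerProductSpace.Core ℂ (HolSection n r E)) :
    functionalI κ h₀ (fubiniStudy hE H) ≤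
      functionalI κ h₀ (fubiniStudy hE (tOperator κ hE H)) := by
  set h := fubiniStudy hE H
  set h' := fubiniStudy hE (tOperator κ hE H)
  obtain ⟨s, hs⟩ := exists_isOrthonormalFor (tOperator κ hE H)
  set f : X → ℂ := fun x => ∑ i, (h.core x).inner (s i x) (s i x) with hf
  have hfi : Integrable f κ.volume :=
    integrable_finsetSum _ fun i _ => integrable_inner_section κ h (s i) (s i)
  have hfr : Integrable (fun x => (f x).re) κ.volume := hfi.re
  have hre : ∫ x, (f x).re ∂κ.volume = (∫ x, f x ∂κ.volume).re := integral_re hfi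
  -- The constant in `Hilb` makes the integral of the trace equal to `r V`, unless `N = 0`.
  have hint : ∫ x, (f x).re ∂κ.volume ≤ κ.totalVolume * r := by
    rw [hre]
    have h1 : ∑ i, (tOperator κ hE H).inner (s i) (s i) =
        (Module.finrank ℂ (HolSection n r E) : ℂ) := by simp [hs _ _]
    rw [sum_hilb_inner] at h1
    rcases Nat.eq_zero_or_pos (Module.finrank ℂ (HolSection n r E)) with hN | hN
    · have : IsEmpty (Fin (Module.finrank ℂ (HolSection n r E))) := by
        rw [hN]; infer_instance
      have h2 : 0 ≤ κ.totalVolume * r := mul_nonneg measureReal_nonneg (Nat.cast_nonneg r)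
      simpa [hf] using h2
    · have h2 := congrArg Complex.re h1
      rw [Complex.re_ofReal_mul, Complex.natCast_re] at h2
      have hN' : (Module.finrank ℂ (HolSection n r E) : ℝ) ≠ 0 := Nat.cast_ne_zero.2 hN.ne'
      have hV : κ.totalVolume * r ≠ 0 := by
        intro h0
        rw [h0, div_zero, zero_mul] at h2
        exact hN' h2.symm
      rw [div_mul_eq_mul_div, div_eq_iff hV] at h2
      exact (mul_left_cancel₀ hN' h2).le
  have hle : functionalI κ h₀ h - functionalI κ h₀ h' ≤ ∫ x, ((f x).re - r) ∂κ.volume := by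
    rw [functionalI, functionalI,
      ← integral_sub (integrable_logDetRel κ h₀ h) (integrable_logDetRel κ h₀ h')]
    exact integral_mono ((integrable_logDetRel κ h₀ h).sub (integrable_logDetRel κ h₀ h'))
      (hfr.sub (integrable_const _)) fun x => logDetRel_sub_le h₀ h h' x
        (isFubiniStudy_fubiniStudy hE (tOperator κ hE H) s hs x)
  rw [integral_sub hfr (integrable_const _), integral_const, smul_eq_mul] at hle
  change _ ≤ _ - κ.totalVolume * r at hle
  linarith

end Relative

end BalancedMetrics

theorem mainTheorem3 {n r : ℕ}
    {X : Type*} [TopologicalSpace X] [CompactSpace X] [T2Space X]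
    [ChartedSpace (Fin n → ℂ) X] [IsManifold 𝓘(ℂ, Fin n → ℂ) ω X]
    [MeasurableSpace X] [BorelSpace X]
    (κ : BalancedMetrics.KahlerForm n X)
    {E : X → Type*} [∀ x, AddCommGroup (E x)] [∀ x, Module ℂ (E x)]
    [∀ x, TopologicalSpace (E x)] [TopologicalSpace (TotalSpace (Fin r → ℂ) E)]
    [FiberBundle (Fin r → ℂ) E] [VectorBundle ℂ (Fin r → ℂ) E]
    [ContMDiffVectorBundle ω (Fin r → ℂ) E 𝓘(ℂ, Fin n → ℂ)]
    (hE : BalancedMetrics.IsGloballyGenerated n r E)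
    (h₀ : BalancedMetrics.HermitianMetric n r E)
    (θ : Module.Basis (Fin (Module.finrank ℂ (BalancedMetrics.HolSection n r E))) ℂ
      (BalancedMetrics.HolSection n r E))
    (H : InnerProductSpace.Core ℂ (BalancedMetrics.HolSection n r E)) :
    BalancedMetrics.functionalZ κ hE h₀ H ≥
        BalancedMetrics.functionalZ κ hE h₀ (BalancedMetrics.tOperator κ hE H) ∧
      BalancedMetrics.logDet θ H ≥
        BalancedMetrics.logDet θ (BalancedMetrics.tOperator κ hE H) ∧
      BalancedMetrics.functionalZTilde κ hE h₀ θ H ≥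
        BalancedMetrics.functionalZTilde κ hE h₀ θ (BalancedMetrics.tOperator κ hE H) := by
  have hZ : BalancedMetrics.functionalZ κ hE h₀ (BalancedMetrics.tOperator κ hE H) ≤
      BalancedMetrics.functionalZ κ hE h₀ H :=
    neg_le_neg (BalancedMetrics.functionalI_fubiniStudy_le κ hE h₀ H)
  have hD := BalancedMetrics.logDet_tOperator_le κ hE θ H
  have hV : 0 ≤ κ.totalVolume := measureReal_nonneg
  exact ⟨hZ, hD, add_le_add hZ (mul_le_mul_of_nonneg_left hD (by positivity))⟩
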